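/- Let $d\ge 1$, let $\mathbb T^d=\mathbb R^d/\mathbb Z^d$, and for $x\in\mathbb T^d$ let $\|x\|=\min_{m\in\mathbb Z^d}|\tilde x-m|$, where $\tilde x\in\mathbb R^d$ is any representative of $x$ and $|\cdot|$ is the Euclidean norm. Let $\{v_n\}_{n\ge1}$ be a $\frac12$-uniformly distributed sequence of points in $\mathbb T^d$; that is, for every $\epsilon>0$ there exists a constant $C'_\epsilon$ such that for every $k\in\mathbb Z^d\setminus\{0\}$ and every integer $N\ge1$, $$\left|\frac1N\sum_{n=1}^N e^{2\pi i k\cdot v_n}\right|\le C'_\epsilon\,|k|^{\epsilon}N^{-1/2}.$$ Fix a distance $0<t<\frac12$. Then for every $\epsilon>0$ there exists a constant $C_\epsilon>0$ (which may depend on $d$, the sequence, $t$ and $\epsilon$, but not on $N$) such that for every integer $N\ge1$, $$\#\left\{(n,m)\in\{1,\dots,N\}^2:\ \|v_n-v_m\|=t\right\}\le C_\epsilon N^{2-\frac{2}{d+1}+\epsilon}.$$ -/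

import Mathlib

/-- The length `|k|` of an integer vector `k ∈ ℤ^d`, as a vector of Euclidean space. -/
noncomputable def latticeNorm {d : ℕ} (k : Fin d → ℤ) : ℝ :=
  ‖(WithLp.toLp 2 (fun i => (k i : ℝ)) : EuclideanSpace ℝ (Fin d))‖

/-- The class in `𝕋^d = ℝ^d / ℤ^d` of a point of Euclidean space. -/
def toTorus {d : ℕ} (y : EuclideanSpace ℝ (Fin d)) : UnitAddTorus (Fin d) :=
  fun i => ((y i : ℝ) : UnitAddCircle)

/-- `‖x‖` on `𝕋^d`: the least Euclidean length of a representative of `x` in `ℝ^d`, that is, the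
Euclidean distance of any representative to the lattice `ℤ^d` (see `isLeast_torusNorm`). The
Riemannian distance of `x` and `y` in `𝕋^d` is `torusNorm (x - y)`. (The norm that Mathlib puts on
`UnitAddTorus` is the sup norm, which is not the one meant.) -/
noncomputable def torusNorm {d : ℕ} (x : UnitAddTorus (Fin d)) : ℝ :=
  sInf {r : ℝ | ∃ y : EuclideanSpace ℝ (Fin d), toTorus y = x ∧ ‖y‖ = r}

/-- A sequence `v 1, v 2, …` of points of `𝕋^d` is `γ`-uniformly distributed: for every `ε > 0`
there is a constant `C`, the same for all `N ≥ 1` and all `k ∈ ℤ^d \ {0}`, with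
`|N⁻¹ ∑_{n=1}^N exp (2 π i k · v n)| ≤ C |k|^ε N^(-γ)`. -/
def UniformlyDistributed {d : ℕ} (γ : ℝ) (v : ℕ → UnitAddTorus (Fin d)) : Prop :=
  ∀ ε : ℝ, 0 < ε → ∃ C : ℝ, ∀ k : Fin d → ℤ, k ≠ 0 → ∀ N : ℕ, 1 ≤ N →
    ‖(1 / (N : ℂ)) * ∑ n ∈ Finset.Icc 1 N, UnitAddTorus.mFourier k (v n)‖
      ≤ C * latticeNorm k ^ ε * (N : ℝ) ^ (-γ)

/-- `torusNorm` is given by the nearest integers to the coordinates, and is attained. -/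
theorem exists_torusNorm {d : ℕ} (x : UnitAddTorus (Fin d)) :
    torusNorm x = Real.sqrt (∑ i, ‖x i‖ ^ 2) ∧
      ∃ y : EuclideanSpace ℝ (Fin d), toTorus y = x ∧ ‖y‖ = torusNorm x := by
  have key : IsLeast {r : ℝ | ∃ y : EuclideanSpace ℝ (Fin d), toTorus y = x ∧ ‖y‖ = r}
      (Real.sqrt (∑ i, ‖x i‖ ^ 2)) := by
    constructor
    · have h : ∀ i, ∃ a : ℝ, (a : UnitAddCircle) = x i ∧ |a| = ‖x i‖ := by
        intro i
        obtain ⟨a, ha⟩ := QuotientAddGroup.mk_surjective (x i)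
        refine ⟨a - round a, ?_, ?_⟩
        · rw [← ha]
          have : ((round a : ℝ) : UnitAddCircle) = 0 :=
            (AddCircle.coe_eq_zero_iff (1 : ℝ)).2 ⟨round a, by simp⟩
          rw [AddCircle.coe_sub, this, sub_zero]
        · rw [← ha]
          exact (UnitAddCircle.norm_eq (x := a)).symm
      choose a ha1 ha2 using h
      refine ⟨WithLp.toLp 2 a, funext fun i => ha1 i, ?_⟩
      rw [EuclideanSpace.norm_eq]
      simp [ha2]
    · rintro r ⟨y, rfl, rfl⟩
      rw [EuclideanSpace.norm_eq]
      refine Real.sqrt_le_sqrt (Finset.sum_le_sum fun i _ => ?_)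
      have : ‖((y i : ℝ) : UnitAddCircle)‖ ≤ ‖y i‖ := by
        rw [UnitAddCircle.norm_eq]
        simpa using round_le (y i) 0
      exact pow_le_pow_left₀ (norm_nonneg _) this 2
  have h := key.csInf_eq
  refine ⟨h, ?_⟩
  obtain ⟨y, hy, hr⟩ := key.1
  exact ⟨y, hy, hr.trans h.symm⟩

theorem isLeast_torusNorm {d : ℕ} (y : EuclideanSpace ℝ (Fin d)) :
    IsLeast (Set.range fun m : Fin d → ℤ =>
      ‖y - (WithLp.toLp 2 (fun i => (m i : ℝ)) : EuclideanSpace ℝ (Fin d))‖)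
      (torusNorm (toTorus y)) := by
  constructor
  · obtain ⟨z, hz, hr⟩ := (exists_torusNorm (toTorus y)).2
    have h : ∀ i, ∃ m : ℤ, (m : ℝ) = y i - z i := by
      intro i
      have h1 : ((y i - z i : ℝ) : UnitAddCircle) = 0 := by
        rw [AddCircle.coe_sub]
        exact sub_eq_zero.2 (congrFun hz i).symm
      obtain ⟨m, hm⟩ := (AddCircle.coe_eq_zero_iff (1 : ℝ)).1 h1
      exact ⟨m, by simpa using hm⟩
    choose m hm using h
    have hz' : y - (WithLp.toLp 2 (fun i => (m i : ℝ)) : EuclideanSpace ℝ (Fin d)) = z := by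
      ext i
      simp [hm]
    exact ⟨m, by simp only [hz', hr]⟩
  · rintro r ⟨m, rfl⟩
    refine csInf_le ⟨0, ?_⟩ ⟨_, funext fun i => ?_, rfl⟩
    · rintro r ⟨z, -, rfl⟩
      exact norm_nonneg z
    · have : ((m i : ℝ) : UnitAddCircle) = 0 :=
        (AddCircle.coe_eq_zero_iff (1 : ℝ)).2 ⟨m i, by simp⟩
      simp [toTorus, this]

/-- On representatives in `ℝ^d` the monomial `mFourier k` is `exp (2 π i k · y)`. -/
theorem mFourier_toTorus {d : ℕ} (k : Fin d → ℤ) (y : EuclideanSpace ℝ (Fin d)) :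
    UnitAddTorus.mFourier k (toTorus y) =
      Complex.exp (2 * Real.pi * Complex.I * ∑ i, (k i : ℂ) * (y i : ℂ)) := by
  simp only [UnitAddTorus.mFourier, ContinuousMap.coe_mk, toTorus, fourier_coe_apply]
  rw [← Complex.exp_sum, Finset.mul_sum]
  congr 1
  refine Finset.sum_congr rfl fun i _ => ?_
  push_cast
  ring

open MeasureTheory

/-!
Pairs of points at distance `t` are detected by the shell `A` of half-width `δ ≍ 1 / M` around the
sphere of radius `t`, smoothed by a Fejér kernel of degree `M`. The smoothed indicator of `A` is
bounded below by a positive constant on the sphere (`le_setIntegral_normSq_boxKernel`), and it is a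
trigonometric polynomial with frequencies `|k i| < M`, whose coefficients are at most those of the
indicator of `A`. Summing over all pairs bounds their number by a constant times
`∑ |Â(k)| |S(k)|²`, where `S(k) = ∑ exp (2 π i k · v n)` (`ncard_pairs_le_sum_freqCube`).

The term `k = 0` is `|A| N² ≪ N² / M`, since shells have measure `O(δ)`
(`exists_torusMeasure_real_torusShell_le`). For `k ≠ 0` uniform distribution gives
`|S(k)|² ≪ M ^ (2 η) N`. No decay of the Fourier transform of the sphere is needed to sum the
coefficients `Â(k)`: by Cauchy–Schwarz over the `O(M ^ d)` frequencies and Bessel's inequality,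
`∑ |Â(k)| ≪ (M ^ d |A|) ^ (1 / 2) ≪ M ^ ((d - 1) / 2)` (`sum_norm_shellCoeff_le`). Hence the number
of pairs is `≪ N² / M + N M ^ ((d - 1) / 2 + 2 η)` (`exists_ncard_pairs_le`), and the choice
`M ≍ N ^ (2 / (d + 1))` gives the exponent `2 - 2 / (d + 1) + ε`.
-/

/-! ### The distance to the lattice and the measure of thin spherical shells -/

/-- The Haar probability measure on `𝕋^d`. -/
noncomputable abbrev torusMeasure (d : ℕ) : Measure (UnitAddTorus (Fin d)) :=
  Measure.pi fun _ => AddCircle.haarAddCircle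

/-- The shell of half-width `δ` around the sphere of radius `t` centred at the origin of `𝕋^d`. -/
def torusShell (d : ℕ) (t δ : ℝ) : Set (UnitAddTorus (Fin d)) :=
  {x | |torusNorm x - t| ≤ δ}

theorem torusNorm_eq_norm {d : ℕ} (x : UnitAddTorus (Fin d)) :
    torusNorm x = ‖(WithLp.toLp 2 fun i => ‖x i‖ : EuclideanSpace ℝ (Fin d))‖ := by
  rw [(exists_torusNorm x).1, EuclideanSpace.norm_eq]
  simp

theorem abs_torusNorm_sub_le {d : ℕ} {x y : UnitAddTorus (Fin d)} {r : ℝ} (hr : 0 ≤ r)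
    (h : ∀ i, ‖x i - y i‖ ≤ r) : |torusNorm x - torusNorm y| ≤ √d * r := by
  rw [torusNorm_eq_norm, torusNorm_eq_norm]
  refine (abs_norm_sub_norm_le _ _).trans ?_
  rw [EuclideanSpace.norm_eq, ← Real.sqrt_sq hr, ← Real.sqrt_mul (by positivity)]
  refine Real.sqrt_le_sqrt ?_
  calc _ ≤ ∑ _i : Fin d, r ^ 2 := Finset.sum_le_sum fun i _ =>
        pow_le_pow_left₀ (norm_nonneg _) ?_ 2
    _ = _ := by simp
  simpa using (abs_norm_sub_norm_le (x i) (y i)).trans (h i)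

theorem measurableSet_torusShell (d : ℕ) (t δ : ℝ) : MeasurableSet (torusShell d t δ) := by
  have : Continuous (torusNorm (d := d)) := by
    rw [show (torusNorm (d := d)) = fun x => Real.sqrt (∑ i, ‖x i‖ ^ 2) from
      funext fun x => (exists_torusNorm x).1]
    fun_prop
  exact measurableSet_le (by fun_prop) measurable_const

theorem haarAddCircle_eq_volume :
    (AddCircle.haarAddCircle : Measure UnitAddCircle) = volume := by
  rw [AddCircle.volume_eq_smul_haarAddCircle]
  simp

theorem torusMeasure_real_box {d : ℕ} {r : ℝ} (hr : 0 ≤ r) (hr' : r ≤ 1 / 2) :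
    (torusMeasure d).real {z | ∀ i, ‖z i‖ ≤ r} = (2 * r) ^ d := by
  have h : {z : UnitAddTorus (Fin d) | ∀ i, ‖z i‖ ≤ r}
      = Set.univ.pi fun _ => Metric.closedBall (0 : UnitAddCircle) r := by
    ext z
    simp
  rw [h, Measure.real, Measure.pi_pi]
  have hb : AddCircle.haarAddCircle (Metric.closedBall (0 : UnitAddCircle) r)
      = ENNReal.ofReal (2 * r) := by
    rw [haarAddCircle_eq_volume, AddCircle.volume_closedBall, min_eq_right (by linarith)]
  simp [hb, ENNReal.toReal_pow, hr]

/-- The shell lifts, inside the unit cube centred at the origin, to a Euclidean shell. -/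
theorem torusMeasure_torusShell_le (d : ℕ) (t δ : ℝ) :
    torusMeasure d (torusShell d t δ)
      ≤ volume {y : EuclideanSpace ℝ (Fin d) | |‖y‖ - t| ≤ δ} := by
  have hmp : MeasurePreserving (fun (x : Fin d → ℝ) => (fun i => (x i : UnitAddCircle)))
      (Measure.pi fun _ => volume.restrict (Set.Ioc (-(1 / 2) : ℝ) (-(1 / 2) + 1)))
      (torusMeasure d) := by
    refine measurePreserving_pi _ _ fun _ => ?_
    rw [haarAddCircle_eq_volume]
    exact UnitAddCircle.measurePreserving_mk _
  have hE : MeasurableSet {y : EuclideanSpace ℝ (Fin d) | |‖y‖ - t| ≤ δ} :=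
    measurableSet_le (by fun_prop) measurable_const
  rw [← hmp.measure_preimage (measurableSet_torusShell d t δ).nullMeasurableSet,
    ← Measure.restrict_pi_pi, ← volume_pi,
    ← (PiLp.volume_preserving_toLp (Fin d)).measure_preimage hE.nullMeasurableSet,
    Measure.restrict_apply (hmp.measurable (measurableSet_torusShell d t δ))]
  refine measure_mono ?_
  rintro x ⟨hx, hx'⟩
  -- On the centred cube the coordinates already are their own shortest representatives.
  have hn : ∀ i, ‖(x i : UnitAddCircle)‖ = |x i| := fun i => by
    obtain ⟨h1, h2⟩ := hx' i trivial
    refine (AddCircle.norm_coe_eq_abs_iff 1 one_ne_zero).2 ?_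
    rw [abs_one, abs_le]
    exact ⟨by linarith, by linarith⟩
  simp only [torusShell, Set.mem_preimage, Set.mem_ofPred_eq, torusNorm_eq_norm, hn] at hx ⊢
  convert hx using 3
  rw [EuclideanSpace.norm_eq, EuclideanSpace.norm_eq]
  simp

theorem volume_real_euclideanShell_le {d : ℕ} (hd : 1 ≤ d) {t δ : ℝ} (ht : 0 ≤ t) (hδ : 0 ≤ δ) :
    volume.real {y : EuclideanSpace ℝ (Fin d) | |‖y‖ - t| ≤ δ}
      ≤ 2 * d * (t + δ) ^ (d - 1) * volume.real (Metric.ball (0 : EuclideanSpace ℝ (Fin d)) 1)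
        * δ := by
  -- The inner radius is truncated at `0`: the shell contains the origin when `t < δ`.
  set s := max (t - δ) 0
  have hs : 0 ≤ s := le_max_right _ _
  have hst : s ≤ t + δ := max_le (by linarith) (by linarith)
  have hsub : {y : EuclideanSpace ℝ (Fin d) | |‖y‖ - t| ≤ δ}
      ⊆ Metric.closedBall 0 (t + δ) \ Metric.ball 0 s := by
    intro y hy
    rw [Set.mem_ofPred_eq, abs_le] at hy
    simp only [Set.mem_sdiff, Metric.mem_closedBall, Metric.mem_ball, dist_zero_right, not_lt]
    exact ⟨by linarith, max_le (by linarith) (norm_nonneg y)⟩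
  refine (measureReal_mono hsub (measure_ne_top_of_subset Set.sdiff_subset
    measure_closedBall_lt_top.ne)).trans ?_
  rw [measureReal_sdiff (Metric.ball_subset_closedBall.trans
    (Metric.closedBall_subset_closedBall hst)) measurableSet_ball
    measure_closedBall_lt_top.ne]
  have : Nonempty (Fin d) := ⟨⟨0, hd⟩⟩
  rw [← Measure.addHaar_real_closedBall_eq_addHaar_real_ball,
    Measure.addHaar_real_closedBall _ _ (hs.trans hst), Measure.addHaar_real_closedBall _ _ hs,
    finrank_euclideanSpace_fin, ← sub_mul]
  have h := abs_pow_sub_pow_le (t + δ) s d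
  rw [abs_of_nonneg (hs.trans hst), abs_of_nonneg hs, max_eq_left hst,
    abs_of_nonneg (sub_nonneg.2 hst)] at h
  have h2 : t + δ - s ≤ 2 * δ := by linarith [le_max_left (t - δ) 0]
  have h3 : (t + δ) ^ d - s ^ d ≤ 2 * δ * d * (t + δ) ^ (d - 1) :=
    (le_abs_self _).trans (h.trans (by gcongr))
  calc _ ≤ 2 * δ * d * (t + δ) ^ (d - 1)
        * volume.real (Metric.ball (0 : EuclideanSpace ℝ (Fin d)) 1) := by gcongr
    _ = _ := by ring

theorem exists_torusMeasure_real_torusShell_le {d : ℕ} (hd : 1 ≤ d) {t : ℝ} (ht : 0 ≤ t) :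
    ∃ C : ℝ, 0 ≤ C ∧ ∀ δ : ℝ, 0 ≤ δ → δ ≤ 1 → (torusMeasure d).real (torusShell d t δ) ≤ C * δ := by
  refine ⟨2 * d * (t + 1) ^ (d - 1) * volume.real (Metric.ball (0 : EuclideanSpace ℝ (Fin d)) 1),
    by positivity, fun δ hδ hδ' => ?_⟩
  have hfin : volume {y : EuclideanSpace ℝ (Fin d) | |‖y‖ - t| ≤ δ} ≠ ⊤ := by
    refine measure_ne_top_of_subset 
      (s := Metric.closedBall (0 : EuclideanSpace ℝ (Fin d)) (t + δ)) (fun y hy => ?_)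
      measure_closedBall_lt_top.ne
    rw [Set.mem_ofPred_eq, abs_le] at hy
    rw [Metric.mem_closedBall, dist_zero_right]
    linarith
  refine (ENNReal.toReal_mono hfin (torusMeasure_torusShell_le d t δ)).trans
    ((volume_real_euclideanShell_le hd ht hδ).trans ?_)
  gcongr

/-! ### Fourier coefficients of the shell -/

/-- The Fourier coefficient at `k` of the indicator function of the shell. -/
noncomputable def shellCoeff (d : ℕ) (t δ : ℝ) (k : Fin d → ℤ) : ℂ :=
  ∫ y in torusShell d t δ, UnitAddTorus.mFourier (-k) y ∂torusMeasure d

theorem mFourier_sub_apply {d : ℕ} (k : Fin d → ℤ) (x y : UnitAddTorus (Fin d)) :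
    UnitAddTorus.mFourier k (x - y) = UnitAddTorus.mFourier k x * UnitAddTorus.mFourier (-k) y := by
  simp only [UnitAddTorus.mFourier, ContinuousMap.coe_mk, ← Finset.prod_mul_distrib]
  refine Finset.prod_congr rfl fun i _ => ?_
  rw [fourier_apply, fourier_apply, fourier_apply, ← Circle.coe_mul, ← AddCircle.toCircle_add,
    Pi.sub_apply, Pi.neg_apply, neg_smul, smul_sub, sub_eq_add_neg]

theorem shellCoeff_zero (d : ℕ) (t δ : ℝ) :
    shellCoeff d t δ 0 = (torusMeasure d).real (torusShell d t δ) := by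
  simp [shellCoeff, UnitAddTorus.mFourier_zero]

/-- Bessel's inequality for the indicator function of the shell. -/
theorem sum_norm_sq_shellCoeff_le (d : ℕ) (t δ : ℝ) (K : Finset (Fin d → ℤ)) :
    ∑ k ∈ K, ‖shellCoeff d t δ k‖ ^ 2 ≤ (torusMeasure d).real (torusShell d t δ) := by
  have hA := measurableSet_torusShell d t δ
  set f := indicatorConstLp (μ := torusMeasure d) 2 hA (measure_ne_top _ _) (1 : ℂ) with hf
  have hfae : f =ᵐ[torusMeasure d] (torusShell d t δ).indicator fun _ => (1 : ℂ) :=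
    indicatorConstLp_coeFn
  have h : HasSum (fun k => ‖UnitAddTorus.mFourierCoeff f k‖ ^ 2)
      (∫ x, ‖f x‖ ^ 2 ∂torusMeasure d) :=
    UnitAddTorus.hasSum_sq_mFourierCoeff f
  have h1 : ∀ k, UnitAddTorus.mFourierCoeff f k = shellCoeff d t δ k := fun k => by
    rw [shellCoeff, ← integral_indicator hA]
    refine integral_congr_ae ?_
    filter_upwards [hfae] with x hx
    rw [hx]
    by_cases hxA : x ∈ torusShell d t δ <;> simp [hxA]
  have h2 : ∫ x, ‖f x‖ ^ 2 ∂torusMeasure d = (torusMeasure d).real (torusShell d t δ) := by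
    rw [← integral_indicator_one hA]
    refine integral_congr_ae ?_
    filter_upwards [hfae] with x hx
    rw [hx]
    by_cases hxA : x ∈ torusShell d t δ <;> simp [hxA]
  rw [h2] at h
  simp only [h1] at h
  exact sum_le_hasSum K (fun k _ => by positivity) h

/-! ### A positive trigonometric kernel -/

/-- The frequencies `j ∈ ℤ^d` with `0 ≤ j i < M` for all `i`. -/
noncomputable def freqBox (d M : ℕ) : Finset (Fin d → ℤ) :=
  Fintype.piFinset fun _ => Finset.Ico 0 (M : ℤ)

/-- The frequencies `k ∈ ℤ^d` with `|k i| < M` for all `i`. -/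
noncomputable def freqCube (d M : ℕ) : Finset (Fin d → ℤ) :=
  Fintype.piFinset fun _ => Finset.Ioo (-(M : ℤ)) (M : ℤ)

theorem card_freqBox (d M : ℕ) : (freqBox d M).card = M ^ d := by
  simp [freqBox]

theorem card_freqCube_le (d M : ℕ) : (freqCube d M).card ≤ (2 * M) ^ d := by
  simp only [freqCube, Fintype.card_piFinset_const, Int.card_Ioo]
  exact Nat.pow_le_pow_left (by omega) _

/-- The `d`-dimensional Dirichlet kernel. Its squared modulus is `M ^ d` times the Fejér kernel. -/
noncomputable def boxKernel (d M : ℕ) (z : UnitAddTorus (Fin d)) : ℂ :=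
  ∑ j ∈ freqBox d M, UnitAddTorus.mFourier j z

/-- Near the origin all the characters of the box have real part at least `1 / 2`. -/
theorem le_norm_boxKernel {d M : ℕ} (hM : 1 ≤ M) {z : UnitAddTorus (Fin d)}
    (hz : ∀ i, ‖z i‖ ≤ 1 / (8 * d * M)) : (M : ℝ) ^ d / 2 ≤ ‖boxKernel d M z‖ := by
  have hrep : ∀ i, ∃ a : ℝ, (a : UnitAddCircle) = z i ∧ |a| = ‖z i‖ := fun i => by
    obtain ⟨a, ha⟩ := QuotientAddGroup.mk_surjective (z i)
    refine ⟨a - round a, ?_, ?_⟩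
    · have h0 : ((round a : ℝ) : UnitAddCircle) = 0 :=
        (AddCircle.coe_eq_zero_iff (1 : ℝ)).2 ⟨round a, by simp⟩
      rw [← ha, AddCircle.coe_sub, h0, sub_zero]
    · rw [← ha]
      exact (UnitAddCircle.norm_eq (x := a)).symm
  choose a ha1 ha2 using hrep
  have hza : z = toTorus (WithLp.toLp 2 a) := funext fun i => (ha1 i).symm
  have hre : ∀ j ∈ freqBox d M, (1 / 2 : ℝ) ≤ (UnitAddTorus.mFourier j z).re := fun j hj => by
    rw [freqBox, Fintype.mem_piFinset] at hj
    -- Each of the `d` terms is at most `M · 1 / (8 d M)`, so the phase is at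
    -- most `2 π / 8 < π / 3`.
    have hphase : |2 * Real.pi * ∑ i, (j i : ℝ) * a i| ≤ Real.pi / 3 := by
      have hsum : |∑ i, (j i : ℝ) * a i| ≤ 1 / 8 := by
        refine (Finset.abs_sum_le_sum_abs _ _).trans ?_
        calc ∑ i, |(j i : ℝ) * a i| ≤ ∑ _i : Fin d, (M : ℝ) * (1 / (8 * d * M)) := by
              refine Finset.sum_le_sum fun i _ => ?_
              have hji := Finset.mem_Ico.1 (hj i)
              rw [abs_mul, ha2]
              refine mul_le_mul ?_ (hz i) (norm_nonneg _) (by positivity)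
              rw [abs_of_nonneg (by exact_mod_cast hji.1)]
              exact_mod_cast hji.2.le
          _ ≤ 1 / 8 := by
              rcases Nat.eq_zero_or_pos d with rfl | hd
              · simp
              · rw [Finset.sum_const, Finset.card_univ, Fintype.card_fin, nsmul_eq_mul]
                field_simp
                norm_num
      rw [abs_mul, abs_of_pos Real.two_pi_pos]
      nlinarith [Real.pi_pos]
    have hexp : UnitAddTorus.mFourier j z
        = Complex.exp ((2 * Real.pi * ∑ i, (j i : ℝ) * a i : ℝ) * Complex.I) := by
      rw [hza, mFourier_toTorus]
      push_cast
      ring_nf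
    rw [hexp, Complex.exp_ofReal_mul_I_re, ← Real.cos_abs, ← Real.cos_pi_div_three]
    exact Real.cos_le_cos_of_nonneg_of_le_pi (abs_nonneg _) (by linarith [Real.pi_pos]) hphase
  calc (M : ℝ) ^ d / 2 = ∑ j ∈ freqBox d M, (1 / 2 : ℝ) := by
        rw [Finset.sum_const, card_freqBox, nsmul_eq_mul]
        push_cast
        ring
    _ ≤ ∑ j ∈ freqBox d M, (UnitAddTorus.mFourier j z).re := Finset.sum_le_sum hre
    _ = (boxKernel d M z).re := by rw [boxKernel, Complex.re_sum]
    _ ≤ _ := Complex.re_le_norm _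

theorem continuous_boxKernel (d M : ℕ) : Continuous (boxKernel d M) := by
  unfold boxKernel
  fun_prop

/-- The expansion of the kernel into characters, with the three variables separated. -/
theorem normSq_boxKernel_sub_sub (d M : ℕ) (x y z : UnitAddTorus (Fin d)) :
    ((‖boxKernel d M (x - y - z)‖ ^ 2 : ℝ) : ℂ) =
      ∑ l ∈ freqBox d M, ∑ j ∈ freqBox d M, UnitAddTorus.mFourier (j - l) x *
        UnitAddTorus.mFourier (-(j - l)) y * UnitAddTorus.mFourier (-(j - l)) z := by
  rw [Complex.ofReal_pow, ← Complex.mul_conj', boxKernel, map_sum, Finset.sum_mul_sum,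
    Finset.sum_comm]
  refine Finset.sum_congr rfl fun l _ => Finset.sum_congr rfl fun j _ => ?_
  rw [← UnitAddTorus.mFourier_neg, ← UnitAddTorus.mFourier_add, ← sub_eq_add_neg,
    mFourier_sub_apply, mFourier_sub_apply]

theorem integrable_normSq_boxKernel_sub {d : ℕ} (M : ℕ) (x : UnitAddTorus (Fin d)) :
    Integrable (fun y => ‖boxKernel d M (x - y)‖ ^ 2) (torusMeasure d) :=
  (((continuous_boxKernel d M).comp
    (continuous_const.sub continuous_id)).norm.pow 2).integrable_of_hasCompactSupport
      (HasCompactSupport.of_compactSpace _)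

/-- If `x` lies on the sphere of radius `t`, a whole box around `x` lies in the shell, and on it the
kernel centred at `x` is large. The constant is `M ^ (2 d) / 4` times the measure of the box,
divided by `M ^ d`, so it does not depend on `M`. -/
theorem le_setIntegral_normSq_boxKernel {d M : ℕ} (hd : 1 ≤ d) (hM : 1 ≤ M) {t : ℝ}
    {x : UnitAddTorus (Fin d)} (hx : torusNorm x = t) :
    (1 / 4 * (1 / (4 * d)) ^ d) * (M : ℝ) ^ d ≤
      ∫ y in torusShell d t (√d * (1 / (8 * d * M))), ‖boxKernel d M (x - y)‖ ^ 2
        ∂torusMeasure d := by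
  have hd' : (1 : ℝ) ≤ d := by exact_mod_cast hd
  have hM' : (1 : ℝ) ≤ M := by exact_mod_cast hM
  set r : ℝ := 1 / (8 * d * M) with hr
  have hr0 : 0 ≤ r := by positivity
  have hr2 : r ≤ 1 / 2 := by
    rw [hr]
    refine one_div_le_one_div_of_le (by norm_num) ?_
    nlinarith
  set B : Set (UnitAddTorus (Fin d)) := (fun y => y - x) ⁻¹' {z | ∀ i, ‖z i‖ ≤ r}
  have hbox : MeasurableSet {z : UnitAddTorus (Fin d) | ∀ i, ‖z i‖ ≤ r} := by
    rw [Set.ofPred_forall]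
    exact MeasurableSet.iInter fun i => measurableSet_le (by fun_prop) measurable_const
  have hsubm : MeasurePreserving (fun y => y - x) (torusMeasure d) (torusMeasure d) :=
    measurePreserving_sub_right _ x
  have hBm : MeasurableSet B := hsubm.measurable hbox
  have hBvol : (torusMeasure d).real B = (2 * r) ^ d := by
    rw [← torusMeasure_real_box hr0 hr2, Measure.real, Measure.real,
      hsubm.measure_preimage hbox.nullMeasurableSet]
  have hBA : B ⊆ torusShell d t (√d * r) := fun y hy => by
    rw [torusShell, Set.mem_ofPred_eq, ← hx]
    exact abs_torusNorm_sub_le hr0 hy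
  have hint := integrable_normSq_boxKernel_sub M x
  calc (1 / 4 * (1 / (4 * d)) ^ d) * (M : ℝ) ^ d
      = ((M : ℝ) ^ d / 2) ^ 2 * (torusMeasure d).real B := by
        rw [hBvol, hr]
        have : (2 * (1 / (8 * d * M)) : ℝ) = 1 / (4 * d) * (1 / M) := by field_simp; norm_num
        rw [this, mul_pow _ (1 / (M : ℝ)), one_div_pow (M : ℝ)]
        field_simp
        norm_num
    _ ≤ ∫ y in B, ‖boxKernel d M (x - y)‖ ^ 2 ∂torusMeasure d := by
        refine setIntegral_ge_of_const_le_real hBm (measure_ne_top _ _) (fun y hy => ?_)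
          hint.integrableOn
        have hz : ∀ i, ‖(x - y) i‖ ≤ r := fun i => by
          rw [Pi.sub_apply, norm_sub_rev]
          exact hy i
        exact pow_le_pow_left₀ (by positivity) (le_norm_boxKernel hM hz) 2
    _ ≤ _ := setIntegral_mono_set hint.integrableOn
        (Filter.Eventually.of_forall fun y => by positivity) hBA.eventuallyLE

/-! ### Counting pairs by exponential sums -/

/-- The exponential sum `∑_{n=1}^N exp (2 π i k · v n)`. -/
noncomputable def expSum {d : ℕ} (v : ℕ → UnitAddTorus (Fin d)) (N : ℕ) (k : Fin d → ℤ) : ℂ :=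
  ∑ n ∈ Finset.Icc 1 N, UnitAddTorus.mFourier k (v n)

theorem setIntegral_normSq_boxKernel_sub_sub {d : ℕ} (M : ℕ) (t δ : ℝ)
    (x y : UnitAddTorus (Fin d)) :
    ((∫ z in torusShell d t δ, ‖boxKernel d M (x - y - z)‖ ^ 2 ∂torusMeasure d : ℝ) : ℂ) =
      ∑ l ∈ freqBox d M, ∑ j ∈ freqBox d M, UnitAddTorus.mFourier (j - l) x *
        UnitAddTorus.mFourier (-(j - l)) y * shellCoeff d t δ (j - l) := by
  have hint : ∀ k : Fin d → ℤ, Integrable (fun z => UnitAddTorus.mFourier k z)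
      ((torusMeasure d).restrict (torusShell d t δ)) := fun k =>
    ((UnitAddTorus.mFourier k).continuous.integrable_of_hasCompactSupport
      (HasCompactSupport.of_compactSpace _))
  rw [← integral_complex_ofReal]
  simp only [normSq_boxKernel_sub_sub]
  rw [integral_finsetSum _ fun l _ => integrable_finsetSum _ fun j _ => (hint _).const_mul _]
  refine Finset.sum_congr rfl fun l _ => ?_
  rw [integral_finsetSum _ fun j _ => (hint _).const_mul _]
  refine Finset.sum_congr rfl fun j _ => ?_
  rw [integral_const_mul, shellCoeff]

/-- Summing over all pairs `(n, m)` turns the characters into squared moduli of exponential sums. -/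
theorem sum_sum_setIntegral_normSq_boxKernel {d : ℕ} (v : ℕ → UnitAddTorus (Fin d)) (M N : ℕ)
    (t δ : ℝ) :
    ((∑ n ∈ Finset.Icc 1 N, ∑ m ∈ Finset.Icc 1 N,
        ∫ z in torusShell d t δ, ‖boxKernel d M (v n - v m - z)‖ ^ 2 ∂torusMeasure d : ℝ) : ℂ) =
      ∑ l ∈ freqBox d M, ∑ j ∈ freqBox d M,
        shellCoeff d t δ (j - l) * (‖expSum v N (j - l)‖ : ℂ) ^ 2 := by
  have hS : ∀ k : Fin d → ℤ, (‖expSum v N k‖ : ℂ) ^ 2 =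
      ∑ n ∈ Finset.Icc 1 N, ∑ m ∈ Finset.Icc 1 N,
        UnitAddTorus.mFourier k (v n) * UnitAddTorus.mFourier (-k) (v m) := fun k => by
    rw [← Complex.mul_conj', expSum, map_sum, Finset.sum_mul_sum]
    simp only [UnitAddTorus.mFourier_neg]
  simp only [Complex.ofReal_sum, setIntegral_normSq_boxKernel_sub_sub, hS, Finset.mul_sum]
  have hcomm : ∀ f : ℕ → ℕ → (Fin d → ℤ) → (Fin d → ℤ) → ℂ,
      ∑ n ∈ Finset.Icc 1 N, ∑ m ∈ Finset.Icc 1 N, ∑ l ∈ freqBox d M, ∑ j ∈ freqBox d M, f n m l j =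
      ∑ l ∈ freqBox d M, ∑ j ∈ freqBox d M, ∑ n ∈ Finset.Icc 1 N, ∑ m ∈ Finset.Icc 1 N,
        f n m l j := fun f => by
    have h : ∀ n, ∑ m ∈ Finset.Icc 1 N, ∑ l ∈ freqBox d M, ∑ j ∈ freqBox d M, f n m l j =
        ∑ l ∈ freqBox d M, ∑ j ∈ freqBox d M, ∑ m ∈ Finset.Icc 1 N, f n m l j := fun n => by
      rw [Finset.sum_comm]
      exact Finset.sum_congr rfl fun l _ => Finset.sum_comm
    rw [Finset.sum_congr rfl fun n _ => h n, Finset.sum_comm]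
    exact Finset.sum_congr rfl fun l _ => Finset.sum_comm
  rw [hcomm]
  refine Finset.sum_congr rfl fun l _ => Finset.sum_congr rfl fun j _ =>
    Finset.sum_congr rfl fun n _ => Finset.sum_congr rfl fun m _ => mul_comm _ _

/-- Every frequency of the cube is a difference of at most `M ^ d` pairs of frequencies of the
box. -/
theorem sum_freqBox_sub_le {d : ℕ} (M : ℕ) {g : (Fin d → ℤ) → ℝ} (hg : ∀ k, 0 ≤ g k) :
    ∑ l ∈ freqBox d M, ∑ j ∈ freqBox d M, g (j - l) ≤ (M : ℝ) ^ d * ∑ k ∈ freqCube d M, g k := by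
  calc _ ≤ ∑ _l ∈ freqBox d M, ∑ k ∈ freqCube d M, g k := ?_
    _ = _ := by
        rw [Finset.sum_const, card_freqBox, nsmul_eq_mul]
        push_cast
        rfl
  refine Finset.sum_le_sum fun l hl => ?_
  rw [← Finset.sum_image (s := freqBox d M) (g := fun j => j - l) (f := g)
    fun a _ b _ h => sub_left_injective h]
  refine Finset.sum_le_sum_of_subset_of_nonneg (fun k hk => ?_) fun k _ _ => hg k
  obtain ⟨j, hj, rfl⟩ := Finset.mem_image.1 hk
  simp only [freqBox, freqCube, Fintype.mem_piFinset, Finset.mem_Ico, Finset.mem_Ioo,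
    Pi.sub_apply] at hl hj ⊢
  exact fun i => ⟨by linarith [(hj i).1, (hl i).2], by linarith [(hj i).2, (hl i).1]⟩

/-- The half-width `√d / (8 d M)` of the shell is half the diagonal of the box on which the kernel
is large. -/
theorem ncard_pairs_le_sum_freqCube {d M : ℕ} (hd : 1 ≤ d) (hM : 1 ≤ M) (t : ℝ)
    (v : ℕ → UnitAddTorus (Fin d)) (N : ℕ) :
    (1 / 4 * (1 / (4 * d)) ^ d) * (Set.ncard {p : ℕ × ℕ | p.1 ∈ Finset.Icc 1 N ∧
        p.2 ∈ Finset.Icc 1 N ∧ torusNorm (v p.1 - v p.2) = t} : ℝ) ≤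
      ∑ k ∈ freqCube d M, ‖shellCoeff d t (√d * (1 / (8 * d * M))) k‖ * ‖expSum v N k‖ ^ 2 := by
  classical
  set δ := √d * (1 / (8 * d * M)) with hδ
  set c : ℝ := 1 / 4 * (1 / (4 * d)) ^ d
  set P := (Finset.Icc 1 N ×ˢ Finset.Icc 1 N).filter fun p => torusNorm (v p.1 - v p.2) = t
  have hP : {p : ℕ × ℕ | p.1 ∈ Finset.Icc 1 N ∧ p.2 ∈ Finset.Icc 1 N ∧
      torusNorm (v p.1 - v p.2) = t} = P := by
    ext p
    simp only [P, Set.mem_ofPred_eq, Finset.coe_filter, Finset.mem_product, and_assoc]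
  rw [hP, Set.ncard_coe_finset]
  set I : ℕ → ℕ → ℝ := fun n m =>
    ∫ z in torusShell d t δ, ‖boxKernel d M (v n - v m - z)‖ ^ 2 ∂torusMeasure d
  have hI : ∀ n m, 0 ≤ I n m := fun n m => integral_nonneg fun z => by positivity
  have hM0 : (0 : ℝ) < (M : ℝ) ^ d := by
    have : (0 : ℝ) < M := by exact_mod_cast hM
    positivity
  have hlow : c * M ^ d * (P.card : ℝ) ≤ ∑ n ∈ Finset.Icc 1 N, ∑ m ∈ Finset.Icc 1 N, I n m := by
    calc c * M ^ d * (P.card : ℝ) = ∑ _p ∈ P, c * (M : ℝ) ^ d := by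
          rw [Finset.sum_const, nsmul_eq_mul, mul_comm]
      _ ≤ ∑ p ∈ P, I p.1 p.2 := Finset.sum_le_sum fun p hp =>
          le_setIntegral_normSq_boxKernel hd hM (Finset.mem_filter.1 hp).2
      _ ≤ ∑ p ∈ Finset.Icc 1 N ×ˢ Finset.Icc 1 N, I p.1 p.2 :=
          Finset.sum_le_sum_of_subset_of_nonneg (Finset.filter_subset _ _) fun p _ _ => hI _ _
      _ = _ := Finset.sum_product _ _ _
  have hup : ∑ n ∈ Finset.Icc 1 N, ∑ m ∈ Finset.Icc 1 N, I n m ≤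
      (M : ℝ) ^ d * ∑ k ∈ freqCube d M, ‖shellCoeff d t δ k‖ * ‖expSum v N k‖ ^ 2 := by
    refine le_trans ?_ (sum_freqBox_sub_le M
      (g := fun k => ‖shellCoeff d t δ k‖ * ‖expSum v N k‖ ^ 2) fun k => by positivity)
    have h := congrArg norm (sum_sum_setIntegral_normSq_boxKernel v M N t δ)
    rw [Complex.norm_real] at h
    refine (Real.le_norm_self _).trans (h.trans_le ((norm_sum_le _ _).trans
      (Finset.sum_le_sum fun l _ => (norm_sum_le _ _).trans
        (Finset.sum_le_sum fun j _ => ?_))))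
    rw [norm_mul, norm_pow, Complex.norm_real, norm_norm]
  refine le_of_mul_le_mul_left ?_ hM0
  calc _ = c * M ^ d * (P.card : ℝ) := by ring
    _ ≤ _ := hlow.trans hup

theorem norm_expSum_zero {d : ℕ} (v : ℕ → UnitAddTorus (Fin d)) (N : ℕ) :
    ‖expSum v N 0‖ = N := by
  simp [expSum, UnitAddTorus.mFourier_zero]

theorem latticeNorm_le_of_mem_freqCube {d M : ℕ} {k : Fin d → ℤ} (hk : k ∈ freqCube d M) :
    latticeNorm k ≤ √d * M := by
  rw [latticeNorm, EuclideanSpace.norm_eq, ← Real.sqrt_sq (Nat.cast_nonneg (α := ℝ) M),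
    ← Real.sqrt_mul (by positivity)]
  refine Real.sqrt_le_sqrt ?_
  calc _ ≤ ∑ _i : Fin d, (M : ℝ) ^ 2 := Finset.sum_le_sum fun i _ =>
        pow_le_pow_left₀ (norm_nonneg _) ?_ 2
    _ = _ := by simp
  have h := Finset.mem_Ioo.1 (Fintype.mem_piFinset.1 hk i)
  rw [PiLp.toLp_apply, Real.norm_eq_abs, abs_le]
  exact ⟨by exact_mod_cast h.1.le, by exact_mod_cast h.2.le⟩

theorem norm_expSum_le {d : ℕ} {v : ℕ → UnitAddTorus (Fin d)}
    (hv : UniformlyDistributed (1 / 2) v) {η : ℝ} (hη : 0 < η) :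
    ∃ C : ℝ, 0 ≤ C ∧ ∀ M N : ℕ, 1 ≤ N → ∀ k ∈ freqCube d M, k ≠ 0 →
      ‖expSum v N k‖ ^ 2 ≤ C * ((M : ℝ) ^ η) ^ 2 * N := by
  obtain ⟨C, hC⟩ := hv η hη
  refine ⟨C ^ 2 * ((√d) ^ η) ^ 2, by positivity, fun M N hN k hk hk0 => ?_⟩
  have hN0 : (0 : ℝ) < N := by exact_mod_cast hN
  have hl : 0 ≤ latticeNorm k := norm_nonneg _
  have h := hC k hk0 N hN
  rw [norm_mul, norm_div, norm_one, Complex.norm_natCast] at h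
  have h1 : ‖expSum v N k‖ ≤ |C| * (√d * M) ^ η * √N := by
    calc ‖expSum v N k‖ = N * (1 / N * ‖expSum v N k‖) := by field_simp
      _ ≤ N * (C * latticeNorm k ^ η * (N : ℝ) ^ (-(1 / 2) : ℝ)) :=
          mul_le_mul_of_nonneg_left h hN0.le
      _ = C * latticeNorm k ^ η * √N := by
          rw [Real.rpow_neg hN0.le, ← Real.sqrt_eq_rpow]
          have := Real.sqrt_pos.2 hN0
          field_simp
          rw [Real.sq_sqrt hN0.le]
          ring
      _ ≤ _ := by
          gcongr
          · exact le_abs_self C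
          · exact latticeNorm_le_of_mem_freqCube hk
  calc ‖expSum v N k‖ ^ 2 ≤ (|C| * (√d * M) ^ η * √N) ^ 2 := by gcongr
    _ = _ := by
      rw [mul_pow, mul_pow, sq_abs, Real.sq_sqrt hN0.le,
        Real.mul_rpow (Real.sqrt_nonneg _) (Nat.cast_nonneg M)]
      ring

/-- Cauchy–Schwarz and Bessel's inequality bound the `ℓ¹` norm of the Fourier coefficients of the
shell over the cube. This replaces pointwise decay estimates for those coefficients. -/
theorem sum_norm_shellCoeff_le (d M : ℕ) (t δ : ℝ) :
    ∑ k ∈ freqCube d M, ‖shellCoeff d t δ k‖ ≤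
      √((2 * M) ^ d * (torusMeasure d).real (torusShell d t δ)) := by
  refine Real.le_sqrt_of_sq_le (sq_sum_le_card_mul_sum_sq.trans ?_)
  refine mul_le_mul ?_ (sum_norm_sq_shellCoeff_le d t δ _) (by positivity) (by positivity)
  exact_mod_cast card_freqCube_le d M

/-- The counting bound before the degree `M` of the kernel is chosen: the first term comes from the
zero frequency, the second one from all the others. -/
theorem exists_ncard_pairs_le {d : ℕ} (hd : 1 ≤ d) {v : ℕ → UnitAddTorus (Fin d)}
    (hv : UniformlyDistributed (1 / 2) v) {t : ℝ} (ht : 0 ≤ t) {η : ℝ} (hη : 0 < η) :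
    ∃ C : ℝ, 0 ≤ C ∧ ∀ M N : ℕ, 1 ≤ M → 1 ≤ N →
      (Set.ncard {p : ℕ × ℕ | p.1 ∈ Finset.Icc 1 N ∧ p.2 ∈ Finset.Icc 1 N ∧
        torusNorm (v p.1 - v p.2) = t} : ℝ) ≤
      C * ((N : ℝ) ^ 2 / M + N * ((M : ℝ) ^ η) ^ 2 * √((M : ℝ) ^ (d - 1))) := by
  obtain ⟨C₁, hC₁, hshell⟩ := exists_torusMeasure_real_torusShell_le hd ht
  obtain ⟨C₂, hC₂, hexp⟩ := norm_expSum_le hv hη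
  have hd0 : (0 : ℝ) < d := by exact_mod_cast hd
  set c : ℝ := 1 / 4 * (1 / (4 * d)) ^ d with hc
  have hc0 : 0 < c := by positivity
  set A := C₁ * (√d * (1 / (8 * d))) with hA
  have hA0 : 0 ≤ A := by positivity
  refine ⟨(A + C₂ * √(2 ^ d * A)) / c, by positivity, fun M N hM hN => ?_⟩
  have hM0 : (1 : ℝ) ≤ M := by exact_mod_cast hM
  set δ := √d * (1 / (8 * d * M)) with hδ
  have hδ1 : δ ≤ 1 := by
    have h1 : √d ≤ d := Real.sqrt_le_self_iff.2 (Or.inr (by exact_mod_cast hd))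
    rw [hδ, mul_one_div, div_le_one (by positivity)]
    nlinarith
  have hvol : (torusMeasure d).real (torusShell d t δ) ≤ A / M := by
    refine (hshell δ (by positivity) hδ1).trans_eq ?_
    rw [hA, hδ]
    field_simp
  have hzero : (0 : Fin d → ℤ) ∈ freqCube d M := by
    simp only [freqCube, Fintype.mem_piFinset, Finset.mem_Ioo, Pi.zero_apply]
    exact fun _ => ⟨by omega, by omega⟩
  have hsqrt : √((2 * M) ^ d * (torusMeasure d).real (torusShell d t δ))
      ≤ √(2 ^ d * A) * √((M : ℝ) ^ (d - 1)) := by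
    rw [← Real.sqrt_mul (by positivity)]
    refine Real.sqrt_le_sqrt ?_
    calc (2 * (M : ℝ)) ^ d * (torusMeasure d).real (torusShell d t δ)
        ≤ (2 * (M : ℝ)) ^ d * (A / M) := by gcongr
      _ = _ := by
          obtain ⟨e, rfl⟩ : ∃ e, d = e + 1 := ⟨d - 1, by omega⟩
          rw [Nat.add_sub_cancel, mul_pow, pow_succ (M : ℝ)]
          field_simp
  rw [div_mul_eq_mul_div, le_div_iff₀' hc0]
  refine (ncard_pairs_le_sum_freqCube hd hM t v N).trans ?_
  rw [← Finset.add_sum_erase _ _ hzero, norm_expSum_zero, shellCoeff_zero, Complex.norm_real,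
    Real.norm_of_nonneg measureReal_nonneg]
  have hrest : ∑ k ∈ (freqCube d M).erase 0, ‖shellCoeff d t δ k‖ * ‖expSum v N k‖ ^ 2 ≤
      (√(2 ^ d * A) * √((M : ℝ) ^ (d - 1))) * (C₂ * ((M : ℝ) ^ η) ^ 2 * N) := by
    calc _ ≤ ∑ k ∈ (freqCube d M).erase 0, ‖shellCoeff d t δ k‖ * (C₂ * ((M : ℝ) ^ η) ^ 2 * N) :=
          Finset.sum_le_sum fun k hk => mul_le_mul_of_nonneg_left
            (hexp M N hN k (Finset.mem_of_mem_erase hk) (Finset.ne_of_mem_erase hk))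
            (norm_nonneg _)
      _ ≤ ∑ k ∈ freqCube d M, ‖shellCoeff d t δ k‖ * (C₂ * ((M : ℝ) ^ η) ^ 2 * N) :=
          Finset.sum_le_sum_of_subset_of_nonneg (Finset.erase_subset _ _)
            fun k _ _ => by positivity
      _ ≤ _ := by
          rw [← Finset.sum_mul]
          gcongr
          exact (sum_norm_shellCoeff_le d M t δ).trans hsqrt
  have hfirst : (torusMeasure d).real (torusShell d t δ) * (N : ℝ) ^ 2 ≤ A * ((N : ℝ) ^ 2 / M) := by
    calc _ ≤ A / M * (N : ℝ) ^ 2 := by gcongr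
      _ = _ := by ring
  refine (add_le_add hfirst hrest).trans ?_
  have h1 : 0 ≤ A * (N * ((M : ℝ) ^ η) ^ 2 * √((M : ℝ) ^ (d - 1))) := by positivity
  have h2 : 0 ≤ C₂ * √(2 ^ d * A) * ((N : ℝ) ^ 2 / M) := by positivity
  linarith

theorem mainTheorem7 (d : ℕ) (hd : 1 ≤ d) (v : ℕ → UnitAddTorus (Fin d))
    (hv : UniformlyDistributed (1 / 2) v) (t : ℝ) (ht0 : 0 < t) (ht : t < 1 / 2) :
    ∀ ε : ℝ, 0 < ε → ∃ C : ℝ, 0 < C ∧ ∀ N : ℕ, 1 ≤ N →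
      (Set.ncard {p : ℕ × ℕ | p.1 ∈ Finset.Icc 1 N ∧ p.2 ∈ Finset.Icc 1 N ∧
        torusNorm (v p.1 - v p.2) = t} : ℝ)
        ≤ C * (N : ℝ) ^ (2 - 2 / ((d : ℝ) + 1) + ε) := by
  intro ε hε
  obtain ⟨C, hC, hcount⟩ := exists_ncard_pairs_le hd hv ht0.le (half_pos hε)
  refine ⟨C * (1 + (2 ^ (ε / 2)) ^ 2 * √(2 ^ (d - 1))) + 1, by positivity, fun N hN => ?_⟩
  have hN1 : (1 : ℝ) ≤ N := by exact_mod_cast hN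
  have hN0 : (0 : ℝ) < N := by linarith
  have hd1 : (1 : ℝ) ≤ d := by exact_mod_cast hd
  -- With `M ≍ N ^ (2 / (d + 1))` the two terms of the bound balance.
  set X : ℝ := (N : ℝ) ^ (2 / ((d : ℝ) + 1)) with hX
  have hX1 : 1 ≤ X := Real.one_le_rpow hN1 (by positivity)
  set M := ⌈X⌉₊ with hMdef
  have hXM : X ≤ M := Nat.le_ceil X
  have hMX : (M : ℝ) ≤ 2 * X := by linarith [Nat.ceil_lt_add_one (by linarith : 0 ≤ X)]
  have hM : 1 ≤ M := by exact_mod_cast hX1.trans hXM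
  refine (hcount M N hM hN).trans ?_
  set Y : ℝ := (N : ℝ) ^ (2 - 2 / ((d : ℝ) + 1) + ε) with hY
  have hfirst : (N : ℝ) ^ 2 / M ≤ Y := by
    calc (N : ℝ) ^ 2 / M ≤ (N : ℝ) ^ 2 / X := by gcongr
      _ = (N : ℝ) ^ (2 - 2 / ((d : ℝ) + 1)) := by
          rw [hX, Real.rpow_sub hN0, Real.rpow_two]
      _ ≤ Y := Real.rpow_le_rpow_of_exponent_le hN1 (by linarith)
  have hsecond : N * ((M : ℝ) ^ (ε / 2)) ^ 2 * √((M : ℝ) ^ (d - 1))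
      ≤ (2 ^ (ε / 2)) ^ 2 * √(2 ^ (d - 1)) * Y := by
    calc N * ((M : ℝ) ^ (ε / 2)) ^ 2 * √((M : ℝ) ^ (d - 1))
        ≤ N * ((2 * X) ^ (ε / 2)) ^ 2 * √((2 * X) ^ (d - 1)) := by gcongr
      _ = (2 ^ (ε / 2)) ^ 2 * √(2 ^ (d - 1)) * (N * (X ^ (ε / 2)) ^ 2 * √(X ^ (d - 1))) := by
          rw [Real.mul_rpow (by norm_num) (by positivity), mul_pow, mul_pow,
            Real.sqrt_mul (by positivity)]
          ring
      _ = (2 ^ (ε / 2)) ^ 2 * √(2 ^ (d - 1)) *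
            (N : ℝ) ^ (2 - 2 / ((d : ℝ) + 1) + 2 / ((d : ℝ) + 1) * ε) := by
          congr 1
          rw [Real.sqrt_eq_rpow, hX, ← Real.rpow_natCast, ← Real.rpow_natCast, Nat.cast_sub hd,
            ← Real.rpow_mul hN0.le, ← Real.rpow_mul hN0.le, ← Real.rpow_mul hN0.le,
            ← Real.rpow_mul hN0.le]
          nth_rewrite 1 [← Real.rpow_one (N : ℝ)]
          rw [← Real.rpow_add hN0, ← Real.rpow_add hN0]
          congr 1
          push_cast
          field_simp
          ring
      _ ≤ _ := by
          have h1 : 2 / ((d : ℝ) + 1) ≤ 1 := by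
            rw [div_le_one (by positivity)]
            linarith
          refine mul_le_mul_of_nonneg_left
            (Real.rpow_le_rpow_of_exponent_le hN1 ?_) (by positivity)
          nlinarith
  have hY0 : 0 ≤ Y := by positivity
  calc _ ≤ C * (Y + (2 ^ (ε / 2)) ^ 2 * √(2 ^ (d - 1)) * Y) := by gcongr
    _ = C * (1 + (2 ^ (ε / 2)) ^ 2 * √(2 ^ (d - 1))) * Y := by ring
    _ ≤ _ := by linarith
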